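/- Let $d\ge 2$, let $A$ be a real $d\times d$ matrix, and let $\lambda_1\ge\dots\ge\lambda_d\ge 0$ be the eigenvalues of $\Sigma=AA^\top$. Assume that the largest eigenvalue is $\lambda_1=1$ and let $m=\#\{j:\lambda_j=\lambda_1\}$ be its multiplicity. Let $U$ be uniformly distributed on the unit sphere of $\mathbb{R}^d$, and let $R$ be a random variable independent of $U$ with $R>0$ almost surely whose tail satisfies $$P(R>u)\sim c\,u^{N}\exp(-\delta u^{\tau}),\qquad u\to\infty,$$ with constants $c,\delta,\tau\in(0,\infty)$ and $N\in\mathbb{R}$ (a Kotz Type III radius). Assume $\delta\tau=1$. Let $X^{(1)},X^{(2)},\dots$ be independent random vectors in $\mathbb{R}^d$, each with the same distribution as $R\,A\,U$. For $s\in\mathbb{R}$ put $b_n^*=[\tau(\ln n+s\ln\ln n)]^{1/\tau}$, which is defined for all sufficiently large $n$. Then, with $\|\cdot\|$ the Euclidean norm, $$P\Bigl(\max_{1\le j\le n}\|X^{(j)}\|\ge b_n^*\ \text{ for infinitely many } n\Bigr)=\begin{cases}1 & \text{if } s\le \frac{m-d}{2}+\frac{N}{\tau}+1,\\[2pt] 0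 & \text{if } s> \frac{m-d}{2}+\frac{N}{\tau}+1.\end{cases}$$ -/

import Mathlib

open MeasureTheory ProbabilityTheory Filter Asymptotics
open scoped Topology Matrix

/-- The matrix `Σ = A Aᵀ` is symmetric. -/
theorem isHermitian_mul_transpose {d : ℕ} (A : Matrix (Fin d) (Fin d) ℝ) :
    (A * Aᵀ).IsHermitian := by
  simpa using Matrix.isHermitian_mul_conjTranspose_self A

/-- The eigenvalues of `Σ = A Aᵀ`, listed with multiplicity. -/
noncomputable def sigmaEigenvalues {d : ℕ} (A : Matrix (Fin d) (Fin d) ℝ) : Fin d → ℝ :=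
  (isHermitian_mul_transpose A).eigenvalues

/-- The largest eigenvalue of `Σ = A Aᵀ`. -/
noncomputable def topEigenvalue {d : ℕ} (A : Matrix (Fin d) (Fin d) ℝ) : ℝ :=
  ⨆ i, sigmaEigenvalues A i

/-- The multiplicity `m` of the largest eigenvalue of `Σ = A Aᵀ`. -/
noncomputable def topMultiplicity {d : ℕ} (A : Matrix (Fin d) (Fin d) ℝ) : ℕ :=
  Nat.card {i : Fin d // sigmaEigenvalues A i = topEigenvalue A}

/-- The uniform distribution on the unit sphere of `ℝ^d`: the surface measure divided by its total
mass, regarded as a measure on `ℝ^d`. -/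
noncomputable def uniformSphere (d : ℕ) : Measure (EuclideanSpace ℝ (Fin d)) :=
  let σ := (volume : Measure (EuclideanSpace ℝ (Fin d))).toSphere
  Measure.map Subtype.val ((σ Set.univ)⁻¹ • σ)

/-- The law of the elliptical random vector `R A U`, where the radius `R` has law `ν`, the vector
`U` is uniformly distributed on the unit sphere, and `R`, `U` are independent. -/
noncomputable def ellipticalLaw {d : ℕ} (A : Matrix (Fin d) (Fin d) ℝ) (ν : Measure ℝ) :
    Measure (EuclideanSpace ℝ (Fin d)) :=
  Measure.map (fun p : ℝ × EuclideanSpace ℝ (Fin d) => p.1 • Matrix.toEuclideanLin A p.2)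
    (ν.prod (uniformSphere d))

/-- The law `ν` is that of an almost surely positive random radius `R` (that is, `F(0) = 0`) with
the Kotz Type III tail `P(R > u) ~ c u^N exp(-δ u^τ)` as `u → ∞`. -/
structure IsKotzIIIRadius (ν : Measure ℝ) (c N δ τ : ℝ) : Prop where
  isProbabilityMeasure : IsProbabilityMeasure ν
  pos : ν (Set.Iic 0) = 0
  tail : (fun u : ℝ => ν.real (Set.Ioi u)) ~[atTop]
    (fun u : ℝ => c * u ^ N * Real.exp (-δ * u ^ τ))

/-- The level `b_n^* = [τ (ln n + s ln ln n)]^{1/τ}`. -/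
noncomputable def bStar (τ s : ℝ) (n : ℕ) : ℝ :=
  (τ * (Real.log n + s * Real.log (Real.log n))) ^ (1 / τ)

/-- The largest norm among the first `n` terms `X 0, …, X (n - 1)` of a sequence of vectors. -/
noncomputable def maxNorm {E : Type*} [Norm E] (X : ℕ → E) (n : ℕ) : ℝ :=
  ⨆ j : Fin n, ‖X j‖

/-! In an eigenbasis of `AᵀA` the norm of `R A U` is `R √(1 - Q(U))`, where `Q(y) = ∑ (1 - λᵢ) yᵢ²`
is nonnegative and degenerate exactly in the `m` top eigendirections. In the variable `t = u ^ τ`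
the tail of `R` is of order `t ^ (N/τ) e^{-δt}`, so shrinking `R` by `√(1 - Q)` costs a factor at
most `e^{-atQ}` for some `a > 0`, and at least a constant where `Q ≤ 1/t`. Averaging this factor
over the sphere gives an order `t ^ (-1/2)` for each of the other `d - m` directions, hence
`P(‖RAU‖ ≥ t ^ (1/τ)) ≍ t ^ (N/τ - (d - m)/2) e^{-δt}`.

At the level `b_n^*` this is of order `n⁻¹ (log n) ^ (N/τ - (d - m)/2 - s)`, which is summable
exactly when the exponent is below `-1`. Since the levels increase to infinity, the running maximum
exceeds them infinitely often if and only if the individual norms do, and the two Borel–Cantelli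
lemmas conclude. -/

open scoped Pointwise in
theorem normalize_preimage_inter_punctured_ball {E : Type*} [NormedAddCommGroup E]
    [NormedSpace ℝ E] (S : Set E) :
    (fun x : E => ‖x‖⁻¹ • x) ⁻¹' S ∩ (Metric.ball 0 1 \ {0}) =
      Set.Ioo (0 : ℝ) 1 • (Subtype.val '' ((Subtype.val : Metric.sphere (0 : E) 1 → E) ⁻¹' S)) := by
  rw [Subtype.image_preimage_coe]
  ext x
  constructor
  · rintro ⟨hxS, hx1, hx0⟩
    have hx : ‖x‖ ≠ 0 := norm_ne_zero_iff.2 hx0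
    refine ⟨‖x‖, ⟨norm_pos_iff.2 hx0, mem_ball_zero_iff.1 hx1⟩, ‖x‖⁻¹ • x, ⟨?_, hxS⟩,
      smul_inv_smul₀ hx x⟩
    simp [norm_smul, hx]
  · rintro ⟨r, ⟨hr0, hr1⟩, y, ⟨hy, hyS⟩, rfl⟩
    have hnorm : ‖r • y‖ = r := by
      rw [norm_smul, mem_sphere_zero_iff_norm.1 hy, mul_one, Real.norm_of_nonneg hr0.le]
    refine ⟨?_, ?_, ?_⟩
    · simpa only [Set.mem_preimage, hnorm, inv_smul_smul₀ hr0.ne'] using hyS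
    · rwa [mem_ball_zero_iff, hnorm]
    · exact norm_ne_zero_iff.1 (hnorm.trans_ne hr0.ne')

section UniformSphere

variable {d : ℕ}

instance : IsFiniteMeasure (uniformSphere d) := by
  unfold uniformSphere
  infer_instance

theorem ae_norm_eq_one_uniformSphere : ∀ᵐ y ∂uniformSphere d, ‖y‖ = 1 := by
  refine (ae_map_iff measurable_subtype_coe.aemeasurable
    (measurableSet_eq_fun measurable_norm measurable_const)).2 (.of_forall fun y => ?_)
  exact mem_sphere_zero_iff_norm.1 y.2

variable [NeZero d]

theorem uniformSphere_eq_map_ball :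
    uniformSphere d =
      (cond volume (Metric.ball (0 : EuclideanSpace ℝ (Fin d)) 1)).map (fun x => ‖x‖⁻¹ • x) := by
  have hm : Measurable fun x : EuclideanSpace ℝ (Fin d) => ‖x‖⁻¹ • x := by fun_prop
  ext S hS
  have hd : (d : ENNReal)⁻¹ * d = 1 :=
    ENNReal.inv_mul_cancel (by exact_mod_cast NeZero.ne d) (ENNReal.natCast_ne_top d)
  rw [Measure.map_apply hm hS, cond_apply' (hm hS), uniformSphere,
    Measure.map_apply measurable_subtype_coe hS, Measure.smul_apply, smul_eq_mul,
    Measure.toSphere_apply' _ (measurable_subtype_coe hS),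
    ← normalize_preimage_inter_punctured_ball, Measure.toSphere_apply_univ,
    finrank_euclideanSpace_fin, ← Set.inter_sdiff_assoc, measure_sdiff_null (measure_singleton _),
    ENNReal.mul_inv (Or.inr measure_ball_lt_top.ne) (Or.inl (ENNReal.natCast_ne_top _)),
    mul_mul_mul_comm, hd, one_mul, Set.inter_comm]

theorem lintegral_uniformSphere {f : EuclideanSpace ℝ (Fin d) → ENNReal} (hf : Measurable f) :
    ∫⁻ y, f y ∂uniformSphere d =
      (volume (Metric.ball (0 : EuclideanSpace ℝ (Fin d)) 1))⁻¹ *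
        ∫⁻ x in Metric.ball 0 1, f (‖x‖⁻¹ • x) := by
  rw [uniformSphere_eq_map_ball, lintegral_map hf (by fun_prop), ProbabilityTheory.cond,
    lintegral_smul_measure, smul_eq_mul]

theorem measurePreserving_uniformSphere
    (e : EuclideanSpace ℝ (Fin d) ≃ₗᵢ[ℝ] EuclideanSpace ℝ (Fin d)) :
    MeasurePreserving e (uniformSphere d) (uniformSphere d) := by
  have hball : e ⁻¹' Metric.ball 0 1 = Metric.ball 0 1 := by simp
  have hcond : MeasurePreserving e (cond volume (Metric.ball 0 1))
      (cond volume (Metric.ball 0 1)) := by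
    have := e.measurePreserving.restrict_preimage
      (measurableSet_ball (x := (0 : EuclideanSpace ℝ (Fin d))) (ε := 1))
    rw [hball] at this
    exact this.smul_measure _
  have hcomm : (e ∘ fun x => ‖x‖⁻¹ • x) = (fun x => ‖x‖⁻¹ • x) ∘ e := by
    ext1 x
    simp
  refine ⟨e.continuous.measurable, ?_⟩
  rw [uniformSphere_eq_map_ball, Measure.map_map e.continuous.measurable (by fun_prop), hcomm,
    ← Measure.map_map (by fun_prop) e.continuous.measurable, hcond.map_eq]

end UniformSphere

section DiagonalForm

variable {ι : Type*}

/-- The rank of the diagonal quadratic form with weights `w`, that is, the number of nonzero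
weights. -/
noncomputable def diagRank (w : ι → ℝ) : ℕ :=
  Nat.card {i // w i ≠ 0}

variable [Fintype ι]

/-- The diagonal quadratic form `∑ wᵢ yᵢ²` on Euclidean space. With the weights `wᵢ = 1 - λᵢ` it
measures by how much a matrix with squared singular values `λᵢ` shortens a unit vector. -/
noncomputable def diagForm (w : ι → ℝ) (y : EuclideanSpace ℝ ι) : ℝ :=
  ∑ i, w i * y i ^ 2

variable (w : ι → ℝ)

@[fun_prop]
theorem continuous_diagForm : Continuous (diagForm w) := by
  unfold diagForm
  fun_prop

theorem diagForm_smul (a : ℝ) (y : EuclideanSpace ℝ ι) :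
    diagForm w (a • y) = a ^ 2 * diagForm w y := by
  simp only [diagForm, PiLp.smul_apply, smul_eq_mul, mul_pow, Finset.mul_sum, mul_left_comm]

theorem diagForm_one_sub (y : EuclideanSpace ℝ ι) :
    diagForm (1 - w) y = ‖y‖ ^ 2 - diagForm w y := by
  simp only [diagForm, EuclideanSpace.real_norm_sq_eq, Pi.sub_apply, Pi.one_apply, sub_mul, one_mul,
    Finset.sum_sub_distrib]

variable {w}

theorem diagForm_nonneg (hw : 0 ≤ w) (y : EuclideanSpace ℝ ι) : 0 ≤ diagForm w y :=
  Finset.sum_nonneg fun i _ => mul_nonneg (hw i) (sq_nonneg _)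

theorem diagForm_le_norm_sq (hw : w ≤ 1) (y : EuclideanSpace ℝ ι) : diagForm w y ≤ ‖y‖ ^ 2 := by
  have := diagForm_nonneg (sub_nonneg.2 hw) y
  rwa [diagForm_one_sub, sub_nonneg] at this

open scoped Classical in
theorem prod_mul_rpow_ite_eq (w c : ι → ℝ) {t : ℝ} (ht : 0 < t) :
    ∏ i, c i * t ^ (if w i = 0 then 0 else -1 / 2 : ℝ) =
      (∏ i, c i) * t ^ (-(diagRank w : ℝ) / 2) := by
  rw [Finset.prod_mul_distrib, ← Real.rpow_sum_of_pos ht, Finset.sum_ite, Finset.sum_const_zero,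
    zero_add, Finset.sum_const, diagRank, Nat.card_eq_fintype_card, Fintype.card_subtype,
    nsmul_eq_mul]
  ring_nf

theorem exists_setIntegral_exp_neg_mul_sq_le {a : ℝ} (ha : 0 ≤ a) :
    ∃ c : ℝ, 0 < c ∧ ∀ t : ℝ, 0 < t →
      ∫ z in Set.Icc (-1 : ℝ) 1, Real.exp (-(t * (a * z ^ 2))) ≤
        c * t ^ (if a = 0 then 0 else -1 / 2 : ℝ) := by
  rcases ha.eq_or_lt with rfl | ha
  · exact ⟨2, two_pos, fun t _ => by norm_num⟩
  refine ⟨√(Real.pi / a), by positivity, fun t ht => ?_⟩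
  have hint : Integrable fun z : ℝ => Real.exp (-(t * a) * z ^ 2) :=
    integrable_exp_neg_mul_sq (by positivity)
  calc ∫ z in Set.Icc (-1 : ℝ) 1, Real.exp (-(t * (a * z ^ 2)))
      = ∫ z in Set.Icc (-1 : ℝ) 1, Real.exp (-(t * a) * z ^ 2) := by
        simp only [neg_mul, mul_assoc]
    _ ≤ ∫ z, Real.exp (-(t * a) * z ^ 2) :=
        setIntegral_le_integral hint (.of_forall fun z => (Real.exp_pos _).le)
    _ = √(Real.pi / a) * t ^ (if a = 0 then 0 else -1 / 2 : ℝ) := by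
        rw [integral_gaussian, if_neg ha.ne', neg_div, Real.rpow_neg ht.le, ← Real.sqrt_eq_rpow,
          ← Real.sqrt_inv, ← Real.sqrt_mul (by positivity)]
        congr 1
        field_simp

theorem lintegral_cube_exp_neg_diagForm (t : ℝ) :
    ∫⁻ y in WithLp.ofLp ⁻¹' Set.univ.pi fun _ => Set.Icc (-1 : ℝ) 1,
        ENNReal.ofReal (Real.exp (-(t * diagForm w y))) =
      ENNReal.ofReal (∏ i, ∫ z in Set.Icc (-1 : ℝ) 1, Real.exp (-(t * (w i * z ^ 2)))) := by
  have hint : Integrable (fun y : ι → ℝ => ∏ i, Real.exp (-(t * (w i * y i ^ 2))))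
      (Measure.pi fun _ => volume.restrict (Set.Icc (-1 : ℝ) 1)) :=
    .fintype_prod fun i => (by fun_prop : Continuous fun z : ℝ =>
      Real.exp (-(t * (w i * z ^ 2)))).continuousOn.integrableOn_Icc
  calc
    _ = ∫⁻ y : EuclideanSpace ℝ ι in WithLp.ofLp ⁻¹' Set.univ.pi fun _ => Set.Icc (-1 : ℝ) 1,
          ENNReal.ofReal (∏ i, Real.exp (-(t * (w i * y.ofLp i ^ 2)))) := by
        simp only [diagForm, Finset.mul_sum, ← Finset.sum_neg_distrib, Real.exp_sum]
    _ = ∫⁻ y : ι → ℝ in Set.univ.pi fun _ => Set.Icc (-1 : ℝ) 1,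
          ENNReal.ofReal (∏ i, Real.exp (-(t * (w i * y i ^ 2)))) :=
        (PiLp.volume_preserving_ofLp ι).setLIntegral_comp_preimage_emb
          (MeasurableEquiv.toLp 2 (ι → ℝ)).symm.measurableEmbedding
          (fun y => ENNReal.ofReal (∏ i, Real.exp (-(t * (w i * y i ^ 2))))) _
    _ = _ := by
        rw [volume_pi, Measure.restrict_pi_pi, ← ofReal_integral_eq_lintegral_ofReal hint
          (.of_forall fun y => Finset.prod_nonneg fun i _ => (Real.exp_pos _).le),
          integral_fintype_prod_eq_prod (f := fun i z => Real.exp (-(t * (w i * z ^ 2))))]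

theorem exists_lintegral_ball_exp_neg_diagForm_le (hw : 0 ≤ w) :
    ∃ C : ℝ, 0 < C ∧ ∀ t : ℝ, 0 < t →
      ∫⁻ y in Metric.ball 0 1, ENNReal.ofReal (Real.exp (-(t * diagForm w y))) ≤
        ENNReal.ofReal (C * t ^ (-(diagRank w : ℝ) / 2)) := by
  choose c hc hint using fun i => exists_setIntegral_exp_neg_mul_sq_le (hw i)
  refine ⟨∏ i, c i, Finset.prod_pos fun i _ => hc i, fun t ht => ?_⟩
  have hball : Metric.ball (0 : EuclideanSpace ℝ ι) 1 ⊆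
      WithLp.ofLp ⁻¹' Set.univ.pi fun _ => Set.Icc (-1 : ℝ) 1 := fun y hy i _ =>
    abs_le.1 ((PiLp.norm_apply_le y i).trans (mem_ball_zero_iff.1 hy).le)
  refine (lintegral_mono_set hball).trans ?_
  rw [lintegral_cube_exp_neg_diagForm, ← prod_mul_rpow_ite_eq w c ht]
  exact ENNReal.ofReal_le_ofReal (Finset.prod_le_prod
    (fun i _ => integral_nonneg fun z => (Real.exp_pos _).le) fun i _ => by convert hint i t ht)

theorem norm_sq_le_card_mul_sq {a : ℝ} {y : EuclideanSpace ℝ ι} (hy : ∀ i, |y i| ≤ a) :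
    ‖y‖ ^ 2 ≤ Fintype.card ι * a ^ 2 := by
  rw [EuclideanSpace.real_norm_sq_eq, ← nsmul_eq_mul]
  exact Finset.sum_le_card_nsmul _ _ _ fun i _ => sq_le_sq.2 ((hy i).trans (le_abs_self a))

theorem diagForm_le_sum_mul_sq (hw : 0 ≤ w) {h : ℝ} {y : EuclideanSpace ℝ ι}
    (hy : ∀ i, w i ≠ 0 → |y i| ≤ h) : diagForm w y ≤ (∑ i, w i) * h ^ 2 := by
  rw [diagForm, Finset.sum_mul]
  refine Finset.sum_le_sum fun i _ => ?_
  by_cases hi : w i = 0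
  · simp only [hi, zero_mul, le_refl]
  · exact mul_le_mul_of_nonneg_left (sq_le_sq.2 ((hy i hi).trans (le_abs_self h))) (hw i)

end DiagonalForm

section NullBox

variable {ι : Type*}

open scoped Classical in
/-- A box of side `a` in the null directions of the weights `w`, and of side `2 * h` in the others.
It stays away from the origin as soon as there is a null direction. -/
def nullBox (w : ι → ℝ) (a h : ℝ) : Set (EuclideanSpace ℝ ι) :=
  WithLp.ofLp ⁻¹' Set.univ.pi fun i => if w i = 0 then Set.Icc a (2 * a) else Set.Icc (-h) h

theorem mem_nullBox {w : ι → ℝ} {a h : ℝ} {y : EuclideanSpace ℝ ι} :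
    y ∈ nullBox w a h ↔
      ∀ i, (w i = 0 → y i ∈ Set.Icc a (2 * a)) ∧ (w i ≠ 0 → |y i| ≤ h) := by
  simp only [nullBox, Set.mem_preimage, Set.mem_univ_pi]
  refine forall_congr' fun i => ?_
  split_ifs with hi <;> simp [hi, abs_le]

variable [Fintype ι] {w : ι → ℝ}

theorem volume_nullBox {a b t : ℝ} (ha : 0 ≤ a) (hb : 0 ≤ b) (ht : 0 < t) :
    volume (nullBox w a (b / √t)) =
      ENNReal.ofReal ((∏ i, if w i = 0 then a else 2 * b) * t ^ (-(diagRank w : ℝ) / 2)) := by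
  classical
  have hside : ∀ i, volume (if w i = 0 then Set.Icc a (2 * a) else Set.Icc (-(b / √t)) (b / √t)) =
      ENNReal.ofReal ((if w i = 0 then a else 2 * b) *
        t ^ (if w i = 0 then 0 else -1 / 2 : ℝ)) := fun i => by
    split_ifs with hi
    · rw [Real.volume_Icc, Real.rpow_zero]
      ring_nf
    · rw [Real.volume_Icc, neg_div, Real.rpow_neg ht.le, ← Real.sqrt_eq_rpow]
      ring_nf
  have hmeas : MeasurableSet (Set.univ.pi fun i =>
      if w i = 0 then Set.Icc a (2 * a) else Set.Icc (-(b / √t)) (b / √t)) :=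
    .univ_pi fun i => by split_ifs <;> exact measurableSet_Icc
  rw [nullBox, (PiLp.volume_preserving_ofLp ι).measure_preimage hmeas.nullMeasurableSet,
    volume_pi_pi]
  simp only [hside]
  rw [← ENNReal.ofReal_prod_of_nonneg fun i _ => by split_ifs <;> positivity,
    prod_mul_rpow_ite_eq w _ ht]

/-- In the box the null directions contribute a norm of order one, while the remaining coordinates
of order `1 / √t` keep the form below `1 / t`. -/
theorem exists_nullBox_subset (hw : 0 ≤ w) (hnull : ∃ i, w i = 0) :
    ∃ a b : ℝ, 0 < a ∧ 0 < b ∧ ∀ t : ℝ, 1 ≤ t →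
      nullBox w a (b / √t) ⊆ Metric.ball 0 1 ∩ {y | diagForm w y ≤ ‖y‖ ^ 2 / t} := by
  obtain ⟨i₀, hi₀⟩ := hnull
  have hn : (1 : ℝ) ≤ Fintype.card ι := by exact_mod_cast Fintype.card_pos_iff.2 ⟨i₀⟩
  set a : ℝ := 1 / (4 * Fintype.card ι) with ha_def
  have ha : 0 < a := by positivity
  have hcard : Fintype.card ι * (2 * a) ^ 2 < 1 := by
    rw [ha_def]
    field_simp
    linarith
  have hW : 0 ≤ ∑ i, w i := Finset.sum_nonneg fun i _ => hw i
  set b : ℝ := a / √(1 + ∑ i, w i) with hb_def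
  have hb : 0 < b := by positivity
  have hbW : (∑ i, w i) * b ^ 2 ≤ a ^ 2 := by
    rw [hb_def, div_pow, Real.sq_sqrt (by positivity), mul_div_assoc', div_le_iff₀ (by positivity)]
    nlinarith [sq_nonneg a]
  have hba : b ≤ a := div_le_self ha.le (Real.one_le_sqrt.2 (by linarith))
  refine ⟨a, b, ha, hb, fun t ht y hy => ?_⟩
  rw [mem_nullBox] at hy
  have hcoord : ∀ i, |y i| ≤ 2 * a := fun i => by
    by_cases hi : w i = 0
    · obtain ⟨hl, hu⟩ := (hy i).1 hi
      exact abs_le.2 ⟨by linarith, hu⟩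
    · linarith [(hy i).2 hi, div_le_self hb.le (Real.one_le_sqrt.2 ht)]
  have hfar : a ≤ ‖y‖ :=
    ((hy i₀).1 hi₀).1.trans ((le_abs_self _).trans (PiLp.norm_apply_le y i₀))
  refine ⟨mem_ball_zero_iff.2 ((sq_lt_one_iff₀ (norm_nonneg y)).1
    ((norm_sq_le_card_mul_sq hcoord).trans_lt hcard)), ?_⟩
  calc diagForm w y ≤ (∑ i, w i) * (b / √t) ^ 2 :=
        diagForm_le_sum_mul_sq hw fun i hi => (hy i).2 hi
    _ = (∑ i, w i) * b ^ 2 / t := by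
        rw [div_pow, Real.sq_sqrt (zero_le_one.trans ht), mul_div_assoc]
    _ ≤ ‖y‖ ^ 2 / t := by
        gcongr
        exact hbW.trans (pow_le_pow_left₀ ha.le hfar 2)

theorem exists_le_volume_ball_diagForm_le (hw : 0 ≤ w) (hnull : ∃ i, w i = 0) :
    ∃ C : ℝ, 0 < C ∧ ∀ t : ℝ, 1 ≤ t →
      ENNReal.ofReal (C * t ^ (-(diagRank w : ℝ) / 2)) ≤
        volume (Metric.ball 0 1 ∩ {y | diagForm w y ≤ ‖y‖ ^ 2 / t}) := by
  classical
  obtain ⟨a, b, ha, hb, hsub⟩ := exists_nullBox_subset hw hnull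
  refine ⟨∏ i, if w i = 0 then a else 2 * b,
    Finset.prod_pos fun i _ => by split_ifs <;> positivity, fun t ht => ?_⟩
  refine le_of_eq_of_le ?_ (measure_mono (hsub t ht))
  rw [volume_nullBox ha.le hb.le (one_pos.trans_le ht)]

end NullBox

section SphereEstimates

variable {d : ℕ}

theorem toReal_volume_unitBall_pos :
    0 < (volume (Metric.ball (0 : EuclideanSpace ℝ (Fin d)) 1)).toReal :=
  ENNReal.toReal_pos (Metric.measure_ball_pos volume _ one_pos).ne' measure_ball_lt_top.ne

variable [NeZero d] {w : Fin d → ℝ}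

/-- Normalising a point of the unit ball increases a nonnegative form, so the Gaussian bound on the
ball passes to the sphere. -/
theorem exists_lintegral_uniformSphere_exp_neg_diagForm_le (hw : 0 ≤ w) :
    ∃ C : ℝ, 0 < C ∧ ∀ t : ℝ, 0 < t →
      ∫⁻ y, ENNReal.ofReal (Real.exp (-(t * diagForm w y))) ∂uniformSphere d ≤
        ENNReal.ofReal (C * t ^ (-(diagRank w : ℝ) / 2)) := by
  obtain ⟨C, hC, hball⟩ := exists_lintegral_ball_exp_neg_diagForm_le hw
  set V := volume (Metric.ball (0 : EuclideanSpace ℝ (Fin d)) 1)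
  have hV : 0 < V.toReal := toReal_volume_unitBall_pos
  have hnormalize : ∀ x ∈ Metric.ball (0 : EuclideanSpace ℝ (Fin d)) 1,
      diagForm w x ≤ diagForm w (‖x‖⁻¹ • x) := fun x hx => by
    rcases eq_or_ne x 0 with rfl | hx0
    · simp
    rw [diagForm_smul]
    exact le_mul_of_one_le_left (diagForm_nonneg hw x) (one_le_pow₀
      ((one_le_inv₀ (norm_pos_iff.2 hx0)).2 (mem_ball_zero_iff.1 hx).le))
  refine ⟨V.toReal⁻¹ * C, by positivity, fun t ht => ?_⟩
  rw [lintegral_uniformSphere (by fun_prop), mul_assoc, ENNReal.ofReal_mul (by positivity),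
    ENNReal.ofReal_inv_of_pos hV, ENNReal.ofReal_toReal measure_ball_lt_top.ne]
  refine mul_le_mul_right ((setLIntegral_mono' measurableSet_ball fun x hx => ?_).trans
    (hball t ht)) _
  have := hnormalize x hx
  gcongr

theorem exists_le_uniformSphere_diagForm_le (hw : 0 ≤ w) (hnull : ∃ i, w i = 0) :
    ∃ C : ℝ, 0 < C ∧ ∀ t : ℝ, 1 ≤ t →
      ENNReal.ofReal (C * t ^ (-(diagRank w : ℝ) / 2)) ≤
        uniformSphere d {y | diagForm w y ≤ 1 / t} := by
  obtain ⟨C, hC, hball⟩ := exists_le_volume_ball_diagForm_le hw hnull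
  set V := volume (Metric.ball (0 : EuclideanSpace ℝ (Fin d)) 1)
  have hV : 0 < V.toReal := toReal_volume_unitBall_pos
  have hcone : ∀ t : ℝ, 1 ≤ t → {y | diagForm w y ≤ ‖y‖ ^ 2 / t} ⊆
      (fun x : EuclideanSpace ℝ (Fin d) => ‖x‖⁻¹ • x) ⁻¹' {y | diagForm w y ≤ 1 / t} := by
    intro t ht x hx
    rcases eq_or_ne x 0 with rfl | hx0
    · simpa [diagForm] using zero_le_one.trans ht
    simp only [Set.mem_preimage, Set.mem_ofPred_eq, diagForm_smul]
    calc ‖x‖⁻¹ ^ 2 * diagForm w x ≤ ‖x‖⁻¹ ^ 2 * (‖x‖ ^ 2 / t) := by gcongr; exact hx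
      _ = 1 / t := by field_simp [norm_ne_zero_iff.2 hx0]
  refine ⟨V.toReal⁻¹ * C, by positivity, fun t ht => ?_⟩
  have hmeas : MeasurableSet {y | diagForm w y ≤ 1 / t} :=
    measurableSet_le (by fun_prop) measurable_const
  have hmap : Measurable fun x : EuclideanSpace ℝ (Fin d) => ‖x‖⁻¹ • x := by fun_prop
  rw [uniformSphere_eq_map_ball, Measure.map_apply hmap hmeas, cond_apply' (hmap hmeas), mul_assoc,
    ENNReal.ofReal_mul (by positivity), ENNReal.ofReal_inv_of_pos hV,
    ENNReal.ofReal_toReal measure_ball_lt_top.ne]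
  refine mul_le_mul_right ((hball t ht).trans (measure_mono ?_)) _
  exact Set.inter_subset_inter_right _ (hcone t ht)

end SphereEstimates

section EllipticalLaw

variable {d : ℕ} (A : Matrix (Fin d) (Fin d) ℝ)

theorem isHermitian_transpose_mul : (Aᵀ * A).IsHermitian := by
  simpa using Matrix.isHermitian_conjTranspose_mul_self A

theorem eigenvalues_transpose_mul :
    (isHermitian_transpose_mul A).eigenvalues = sigmaEigenvalues A :=
  ((isHermitian_transpose_mul A).eigenvalues_eq_eigenvalues_iff
    (isHermitian_mul_transpose A)).2 (Matrix.charpoly_mul_comm _ _)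

theorem sigmaEigenvalues_nonneg : 0 ≤ sigmaEigenvalues A := by
  have h : (A * Aᵀ).PosSemidef := by simpa using Matrix.posSemidef_self_mul_conjTranspose A
  exact h.eigenvalues_nonneg

theorem sigmaEigenvalues_le_topEigenvalue (i : Fin d) : sigmaEigenvalues A i ≤ topEigenvalue A :=
  le_ciSup (Set.finite_range _).bddAbove i

theorem exists_sigmaEigenvalues_eq_topEigenvalue [NeZero d] :
    ∃ i, sigmaEigenvalues A i = topEigenvalue A :=
  exists_eq_ciSup_of_finite

theorem diagRank_one_sub_sigmaEigenvalues (hA : topEigenvalue A = 1) :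
    (diagRank (1 - sigmaEigenvalues A) : ℝ) = d - topMultiplicity A := by
  classical
  have hcompl : topMultiplicity A + diagRank (1 - sigmaEigenvalues A) = d := by
    simpa only [topMultiplicity, diagRank, hA, Pi.sub_apply, Pi.one_apply, sub_ne_zero,
      ne_comm (a := (1 : ℝ)), Nat.card_eq_fintype_card, Fintype.card_fin, Fintype.card_sum] using
      Fintype.card_congr (Equiv.sumCompl fun i => sigmaEigenvalues A i = 1)
  rw [eq_sub_iff_add_eq', ← Nat.cast_add, hcompl]

theorem toEuclideanLin_transpose_mul_eigenvectorBasis (i : Fin d) :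
    Matrix.toEuclideanLin (Aᵀ * A) ((isHermitian_transpose_mul A).eigenvectorBasis i) =
      sigmaEigenvalues A i • (isHermitian_transpose_mul A).eigenvectorBasis i := by
  rw [← eigenvalues_transpose_mul]
  ext j
  simpa [Matrix.toLpLin_apply] using
    congrFun ((isHermitian_transpose_mul A).mulVec_eigenvectorBasis i) j

theorem norm_toEuclideanLin_sq (x : EuclideanSpace ℝ (Fin d)) :
    ‖Matrix.toEuclideanLin A x‖ ^ 2 =
      diagForm (sigmaEigenvalues A) ((isHermitian_transpose_mul A).eigenvectorBasis.repr x) := by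
  set b := (isHermitian_transpose_mul A).eigenvectorBasis
  have hadjoint : Matrix.toEuclideanLin (Aᵀ * A) x =
      LinearMap.adjoint (Matrix.toEuclideanLin A) (Matrix.toEuclideanLin A x) := by
    rw [← Matrix.toEuclideanLin_conjTranspose_eq_adjoint]
    simp [Matrix.toLpLin_apply]
  have hexpand : Matrix.toEuclideanLin (Aᵀ * A) x =
      ∑ i, b.repr x i • sigmaEigenvalues A i • b i := by
    conv_lhs => rw [← b.sum_repr x, map_sum]
    exact Finset.sum_congr rfl fun i _ => by
      rw [map_smul, toEuclideanLin_transpose_mul_eigenvectorBasis]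
  rw [← real_inner_self_eq_norm_sq, ← LinearMap.adjoint_inner_right, ← hadjoint, hexpand, inner_sum]
  refine Finset.sum_congr rfl fun i _ => ?_
  rw [real_inner_smul_right, real_inner_smul_right, real_inner_comm, ← b.repr_apply_apply]
  ring

theorem measurable_smul_toEuclideanLin :
    Measurable fun p : ℝ × EuclideanSpace ℝ (Fin d) => p.1 • Matrix.toEuclideanLin A p.2 := by
  have h : Continuous (Matrix.toEuclideanLin A) := LinearMap.continuous_of_finiteDimensional _
  exact (continuous_fst.smul (h.comp continuous_snd)).measurable

/-- In the eigenbasis of `Aᵀ A` the matrix `A` shortens a unit vector `y` by the factor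
`√(1 - diagForm (1 - λ) y)`, and the uniform distribution is the same in every orthonormal basis. -/
theorem ellipticalLaw_norm_ge [NeZero d] (ν : Measure ℝ) [SFinite ν] (u : ℝ) :
    ellipticalLaw A ν {x | u ≤ ‖x‖} =
      ∫⁻ y, ν {r | u ≤ |r| * √(1 - diagForm (1 - sigmaEigenvalues A) y)} ∂uniformSphere d := by
  have hS : MeasurableSet {x : EuclideanSpace ℝ (Fin d) | u ≤ ‖x‖} :=
    measurableSet_le measurable_const measurable_norm
  have hm := measurable_smul_toEuclideanLin A
  set b := (isHermitian_transpose_mul A).eigenvectorBasis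
  rw [ellipticalLaw, Measure.map_apply hm hS, Measure.prod_apply_symm (hm hS)]
  refine Eq.trans (lintegral_congr_ae ?_)
    ((measurePreserving_uniformSphere b.repr).lintegral_comp_emb
      b.repr.toHomeomorph.measurableEmbedding _)
  filter_upwards [ae_norm_eq_one_uniformSphere] with x hx
  congr 1
  ext r
  simp only [Set.mem_preimage, Set.mem_ofPred_eq]
  rw [norm_smul, Real.norm_eq_abs, diagForm_one_sub, b.repr.norm_map, hx, one_pow, sub_sub_cancel,
    ← norm_toEuclideanLin_sq, Real.sqrt_sq (norm_nonneg _)]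

end EllipticalLaw

section GammaProfile

/-- The function `t ^ M * exp (-δ t)`, the shape of a Kotz Type III tail in the variable
`t = u ^ τ`. -/
noncomputable def gammaProfile (M δ t : ℝ) : ℝ :=
  t ^ M * Real.exp (-(δ * t))

variable {M δ t : ℝ}

theorem gammaProfile_pos (ht : 0 < t) : 0 < gammaProfile M δ t := by
  unfold gammaProfile
  positivity

theorem gammaProfile_mul_rpow (ht : 0 < t) (a : ℝ) :
    gammaProfile M δ t * t ^ a = gammaProfile (M + a) δ t := by
  rw [gammaProfile, gammaProfile, Real.rpow_add ht, mul_right_comm]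

theorem isTheta_gammaProfile_add_const (M δ a : ℝ) :
    (fun t => gammaProfile M δ (t + a)) =Θ[atTop] gammaProfile M δ := by
  have hshift : (fun t : ℝ => t + a) =Θ[atTop] (fun t => t) :=
    (IsEquivalent.refl.add_isLittleO (isLittleO_const_id_atTop a)).isTheta
  have hpow : (fun t : ℝ => (t + a) ^ M) =Θ[atTop] (fun t => t ^ M) :=
    hshift.rpow ((tendsto_atTop_add_const_right _ a tendsto_id).eventually_ge_atTop 0)
      (eventually_ge_atTop 0)
  have hexp : (fun t : ℝ => Real.exp (-(δ * (t + a)))) =Θ[atTop]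
      (fun t => Real.exp (-(δ * t))) := by
    simp only [mul_add, neg_add_rev, Real.exp_add]
    exact (isTheta_const_mul_left (Real.exp_ne_zero _)).2 (isTheta_refl _ _)
  exact hpow.mul hexp

theorem eventually_gammaProfile_mul_one_add_le (M : ℝ) (hδ : 0 < δ) :
    ∀ᶠ t : ℝ in atTop, ∀ x : ℝ, 0 ≤ x →
      gammaProfile M δ (t * (1 + x)) ≤ gammaProfile M δ t * Real.exp (-(δ / 2 * t * x)) := by
  filter_upwards [eventually_gt_atTop 0, eventually_ge_atTop (|M| / (δ / 2))] with t ht htM x hx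
  have hpow : (1 + x) ^ M ≤ Real.exp (δ / 2 * t * x) :=
    calc (1 + x) ^ M ≤ (1 + x) ^ |M| :=
          Real.rpow_le_rpow_of_exponent_le (by linarith) (le_abs_self M)
      _ ≤ Real.exp x ^ |M| := by
          gcongr
          linarith [Real.add_one_le_exp x]
      _ = Real.exp (|M| * x) := by rw [← Real.exp_mul, mul_comm]
      _ ≤ Real.exp (δ / 2 * t * x) := by
          gcongr
          rwa [div_le_iff₀' (half_pos hδ)] at htM
  calc gammaProfile M δ (t * (1 + x))
      = gammaProfile M δ t * ((1 + x) ^ M * Real.exp (-(δ * t * x))) := by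
        rw [gammaProfile, gammaProfile, Real.mul_rpow ht.le (by linarith), mul_mul_mul_comm,
          ← Real.exp_add]
        ring_nf
    _ ≤ gammaProfile M δ t * (Real.exp (δ / 2 * t * x) * Real.exp (-(δ * t * x))) := by
        have := (gammaProfile_pos (M := M) (δ := δ) ht).le
        gcongr
    _ = gammaProfile M δ t * Real.exp (-(δ / 2 * t * x)) := by
        rw [← Real.exp_add]
        ring_nf

end GammaProfile

section ScaledRadius

variable {a q r t x τ : ℝ}

theorem one_sub_rpow_mul_one_add_mul_le_one (ha : 0 ≤ a) (hq0 : 0 ≤ q) (hq1 : q ≤ 1) :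
    (1 - q) ^ a * (1 + a * q) ≤ 1 :=
  calc (1 - q) ^ a * (1 + a * q) ≤ Real.exp (-q) ^ a * Real.exp (a * q) := by
        have := sub_nonneg.2 hq1
        gcongr
        · exact Real.one_sub_le_exp_neg q
        · linarith [Real.add_one_le_exp (a * q)]
    _ = 1 := by rw [← Real.exp_mul, ← Real.exp_add, neg_mul, mul_comm q, neg_add_cancel,
          Real.exp_zero]

theorem one_sub_max_one_mul_le_rpow (a : ℝ) (hq0 : 0 ≤ q) (hq1 : q < 1) :
    1 - max a 1 * q ≤ (1 - q) ^ a :=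
  calc 1 - max a 1 * q ≤ (1 - q) ^ max a 1 := by
        simpa only [sub_eq_add_neg, mul_neg] using
          one_add_mul_self_le_rpow_one_add (by linarith : -1 ≤ -q) (le_max_right a 1)
    _ ≤ (1 - q) ^ a :=
        Real.rpow_le_rpow_of_exponent_ge (by linarith) (by linarith) (le_max_left a 1)

theorem rpow_one_div_le_abs_mul_sqrt_iff (hτ : 0 < τ) (ht : 0 ≤ t) (hx : 0 ≤ x) :
    t ^ (1 / τ) ≤ |r| * √x ↔ t ≤ |r| ^ τ * x ^ (τ / 2) := by
  rw [one_div, Real.rpow_inv_le_iff_of_pos ht (by positivity) hτ,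
    Real.mul_rpow (abs_nonneg r) (Real.sqrt_nonneg x), Real.sqrt_eq_rpow, ← Real.rpow_mul hx,
    one_div_mul_eq_div]

theorem rpow_le_abs_of_le_abs_mul_sqrt (hτ : 0 < τ) (ht : 0 ≤ t) (hq0 : 0 ≤ q) (hq1 : q ≤ 1)
    (h : t ^ (1 / τ) ≤ |r| * √(1 - q)) : (t * (1 + τ / 2 * q)) ^ (1 / τ) ≤ |r| := by
  rw [rpow_one_div_le_abs_mul_sqrt_iff hτ ht (sub_nonneg.2 hq1)] at h
  rw [one_div, Real.rpow_inv_le_iff_of_pos (by positivity) (abs_nonneg r) hτ]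
  calc t * (1 + τ / 2 * q) ≤ |r| ^ τ * (1 - q) ^ (τ / 2) * (1 + τ / 2 * q) := by gcongr
    _ ≤ |r| ^ τ := by
        rw [mul_assoc]
        exact mul_le_of_le_one_right (by positivity)
          (one_sub_rpow_mul_one_add_mul_le_one (by positivity) hq0 hq1)

theorem rpow_le_abs_mul_sqrt_of_le_abs (hτ : 0 < τ) (ht : 2 * max (τ / 2) 1 ≤ t) (hq0 : 0 ≤ q)
    (hq1 : q ≤ 1 / t) (h : (t + 2 * max (τ / 2) 1) ^ (1 / τ) ≤ |r|) :
    t ^ (1 / τ) ≤ |r| * √(1 - q) := by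
  set b := max (τ / 2) 1 with hb_def
  have hb : 1 ≤ b := le_max_right _ _
  have ht0 : 0 < t := by linarith
  have hqt : t * q ≤ 1 := by rwa [le_div_iff₀' ht0] at hq1
  have hq : q < 1 := by nlinarith
  rw [one_div, Real.rpow_inv_le_iff_of_pos (by positivity) (abs_nonneg r) hτ] at h
  rw [rpow_one_div_le_abs_mul_sqrt_iff hτ ht0.le (sub_nonneg.2 hq.le)]
  have htbq : (t + 2 * b) * q ≤ 2 := by nlinarith
  calc t ≤ (t + 2 * b) * (1 - b * q) := by nlinarith
    _ ≤ (t + 2 * b) * (1 - q) ^ (τ / 2) := by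
        gcongr
        exact one_sub_max_one_mul_le_rpow (τ / 2) hq0 hq
    _ ≤ |r| ^ τ * (1 - q) ^ (τ / 2) := by
        have := Real.rpow_nonneg (sub_nonneg.2 hq.le) (τ / 2)
        gcongr

end ScaledRadius

namespace IsKotzIIIRadius

variable {ν : Measure ℝ} {c N δ τ : ℝ}

theorem isTheta_measureReal_Ioi (hν : IsKotzIIIRadius ν c N δ τ) (hc : c ≠ 0) (hτ : 0 < τ) :
    (fun t => ν.real (Set.Ioi (t ^ (1 / τ)))) =Θ[atTop] gammaProfile (N / τ) δ := by
  have htail := (hν.tail.comp_tendsto (tendsto_rpow_atTop (one_div_pos.2 hτ))).isTheta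
  have hprofile : (fun t : ℝ => c * (t ^ (1 / τ)) ^ N * Real.exp (-δ * (t ^ (1 / τ)) ^ τ))
      =ᶠ[atTop] fun t => c * gammaProfile (N / τ) δ t := by
    filter_upwards [eventually_ge_atTop 0] with t ht
    rw [gammaProfile, ← Real.rpow_mul ht, ← Real.rpow_mul ht, one_div_mul_cancel hτ.ne',
      Real.rpow_one, one_div_mul_eq_div, neg_mul, mul_assoc]
  exact htail.trans (hprofile.isTheta.trans ((isTheta_const_mul_left hc).2 (isTheta_refl _ _)))

theorem isTheta_measureReal_Ici (hν : IsKotzIIIRadius ν c N δ τ) (hc : c ≠ 0) (hτ : 0 < τ) :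
    (fun t => ν.real (Set.Ici (t ^ (1 / τ)))) =Θ[atTop] gammaProfile (N / τ) δ := by
  have := hν.isProbabilityMeasure
  have hIoi := hν.isTheta_measureReal_Ioi hc hτ
  constructor
  · have hshift := hIoi.isBigO.comp_tendsto (tendsto_atTop_add_const_right _ (-1 : ℝ) tendsto_id)
    refine (IsBigO.of_norm_eventuallyLE ?_).trans
      (hshift.trans (isTheta_gammaProfile_add_const (N / τ) δ (-1)).isBigO)
    filter_upwards [eventually_ge_atTop 1] with t ht
    rw [Real.norm_of_nonneg measureReal_nonneg]
    refine measureReal_mono fun r hr => ?_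
    exact (Real.rpow_lt_rpow (by simpa using ht) (by simp) (one_div_pos.2 hτ)).trans_le hr
  · refine hIoi.isBigO_symm.trans (IsBigO.of_norm_le fun t => ?_)
    rw [Real.norm_of_nonneg measureReal_nonneg]
    exact measureReal_mono Set.Ioi_subset_Ici_self

theorem exists_eventually_scaled_tail_le (hν : IsKotzIIIRadius ν c N δ τ) (hc : c ≠ 0)
    (hδ : 0 < δ) (hτ : 0 < τ) :
    ∃ C : ℝ, 0 < C ∧ ∀ᶠ t : ℝ in atTop, ∀ q : ℝ, 0 ≤ q → q ≤ 1 →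
      ν {r | t ^ (1 / τ) ≤ |r| * √(1 - q)} ≤
        ENNReal.ofReal (C * gammaProfile (N / τ) δ t * Real.exp (-(δ * τ / 4 * t * q))) := by
  have := hν.isProbabilityMeasure
  obtain ⟨C, hC, htail⟩ := (hν.isTheta_measureReal_Ici hc hτ).isBigO.exists_pos
  refine ⟨C, hC, ?_⟩
  filter_upwards [eventually_forall_ge_atTop.2 htail.bound, eventually_gt_atTop 0,
    eventually_gammaProfile_mul_one_add_le (N / τ) hδ] with t htail ht hprofile q hq0 hq1
  have hpos : ∀ᵐ r ∂ν, 0 < r := by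
    filter_upwards [measure_eq_zero_iff_ae_notMem.1 hν.pos] with r hr using not_le.1 hr
  have hsub : {r | t ^ (1 / τ) ≤ |r| * √(1 - q)} ≤ᵐ[ν]
      Set.Ici ((t * (1 + τ / 2 * q)) ^ (1 / τ)) := by
    filter_upwards [hpos] with r hr h
    exact abs_of_pos hr ▸ rpow_le_abs_of_le_abs_mul_sqrt hτ ht.le hq0 hq1 h
  have hq : 0 ≤ τ / 2 * q := by positivity
  have ht' : t ≤ t * (1 + τ / 2 * q) := le_mul_of_one_le_right ht.le (by linarith)
  refine (measure_mono_ae hsub).trans ?_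
  rw [← ofReal_measureReal]
  refine ENNReal.ofReal_le_ofReal ((Real.le_norm_self _).trans ((htail _ ht').trans ?_))
  rw [Real.norm_of_nonneg (gammaProfile_pos (ht.trans_le ht')).le, mul_assoc]
  refine mul_le_mul_of_nonneg_left ((hprofile _ hq).trans_eq ?_) hC.le
  ring_nf

theorem exists_eventually_le_scaled_tail (hν : IsKotzIIIRadius ν c N δ τ) (hc : c ≠ 0)
    (hτ : 0 < τ) :
    ∃ C : ℝ, 0 < C ∧ ∀ᶠ t : ℝ in atTop, ∀ q : ℝ, 0 ≤ q → q ≤ 1 / t →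
      ENNReal.ofReal (C * gammaProfile (N / τ) δ t) ≤
        ν {r | t ^ (1 / τ) ≤ |r| * √(1 - q)} := by
  have := hν.isProbabilityMeasure
  set b := 2 * max (τ / 2) 1
  have hshift : (fun t => gammaProfile (N / τ) δ (t + b)) =O[atTop]
      fun t => ν.real (Set.Ici ((t + b) ^ (1 / τ))) :=
    (hν.isTheta_measureReal_Ici hc hτ).isBigO_symm.comp_tendsto
      (tendsto_atTop_add_const_right _ b tendsto_id)
  obtain ⟨C, hC, htail⟩ :=
    ((isTheta_gammaProfile_add_const (N / τ) δ b).isBigO_symm.trans hshift).exists_pos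
  refine ⟨C⁻¹, inv_pos.2 hC, ?_⟩
  filter_upwards [htail.bound, eventually_gt_atTop 0, eventually_ge_atTop b]
    with t htail ht htb q hq0 hq1
  have hsub : Set.Ici ((t + b) ^ (1 / τ)) ⊆ {r | t ^ (1 / τ) ≤ |r| * √(1 - q)} := fun r hr =>
    rpow_le_abs_mul_sqrt_of_le_abs hτ htb hq0 hq1 (le_trans hr (le_abs_self r))
  refine le_trans ?_ (measure_mono hsub)
  rw [Real.norm_of_nonneg (gammaProfile_pos ht).le, Real.norm_of_nonneg measureReal_nonneg] at htail
  rw [← ofReal_measureReal]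
  exact ENNReal.ofReal_le_ofReal ((inv_mul_le_iff₀ hC).2 htail)

variable {d : ℕ} [NeZero d] {w : Fin d → ℝ}

theorem exists_eventually_lintegral_scaled_tail_le (hν : IsKotzIIIRadius ν c N δ τ) (hc : c ≠ 0)
    (hδ : 0 < δ) (hτ : 0 < τ) (hw0 : 0 ≤ w) (hw1 : w ≤ 1) :
    ∃ C : ℝ, 0 < C ∧ ∀ᶠ t : ℝ in atTop,
      ∫⁻ y, ν {r | t ^ (1 / τ) ≤ |r| * √(1 - diagForm w y)} ∂uniformSphere d ≤
        ENNReal.ofReal (C * gammaProfile (N / τ + -(diagRank w : ℝ) / 2) δ t) := by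
  obtain ⟨C₁, hC₁, hscaled⟩ := hν.exists_eventually_scaled_tail_le hc hδ hτ
  obtain ⟨C₂, hC₂, hsphere⟩ := exists_lintegral_uniformSphere_exp_neg_diagForm_le hw0
  have hε : 0 < δ * τ / 4 := by positivity
  refine ⟨C₁ * C₂ * (δ * τ / 4) ^ (-(diagRank w : ℝ) / 2), by positivity, ?_⟩
  filter_upwards [hscaled, eventually_gt_atTop 0] with t hscaled ht
  have hg := (gammaProfile_pos (M := N / τ) (δ := δ) ht).le
  calc ∫⁻ y, ν {r | t ^ (1 / τ) ≤ |r| * √(1 - diagForm w y)} ∂uniformSphere d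
      ≤ ∫⁻ y, ENNReal.ofReal (C₁ * gammaProfile (N / τ) δ t) *
          ENNReal.ofReal (Real.exp (-(δ * τ / 4 * t * diagForm w y))) ∂uniformSphere d := by
        refine lintegral_mono_ae ?_
        filter_upwards [ae_norm_eq_one_uniformSphere] with y hy
        rw [← ENNReal.ofReal_mul (by positivity)]
        refine hscaled _ (diagForm_nonneg hw0 y) ?_
        simpa only [hy, one_pow] using diagForm_le_norm_sq hw1 y
    _ ≤ ENNReal.ofReal (C₁ * gammaProfile (N / τ) δ t) *
          ENNReal.ofReal (C₂ * (δ * τ / 4 * t) ^ (-(diagRank w : ℝ) / 2)) := by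
        rw [lintegral_const_mul _ (by fun_prop)]
        gcongr
        exact hsphere _ (by positivity)
    _ = _ := by
        rw [← ENNReal.ofReal_mul (by positivity), Real.mul_rpow hε.le ht.le,
          ← gammaProfile_mul_rpow ht]
        ring_nf

theorem exists_eventually_le_lintegral_scaled_tail (hν : IsKotzIIIRadius ν c N δ τ) (hc : c ≠ 0)
    (hτ : 0 < τ) (hw : 0 ≤ w) (hnull : ∃ i, w i = 0) :
    ∃ C : ℝ, 0 < C ∧ ∀ᶠ t : ℝ in atTop,
      ENNReal.ofReal (C * gammaProfile (N / τ + -(diagRank w : ℝ) / 2) δ t) ≤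
        ∫⁻ y, ν {r | t ^ (1 / τ) ≤ |r| * √(1 - diagForm w y)} ∂uniformSphere d := by
  obtain ⟨C₁, hC₁, hscaled⟩ := hν.exists_eventually_le_scaled_tail hc hτ
  obtain ⟨C₂, hC₂, hsphere⟩ := exists_le_uniformSphere_diagForm_le hw hnull
  refine ⟨C₁ * C₂, by positivity, ?_⟩
  filter_upwards [hscaled, eventually_ge_atTop 1] with t hscaled ht
  have ht0 : 0 < t := one_pos.trans_le ht
  have hg := (gammaProfile_pos (M := N / τ) (δ := δ) ht0).le
  have hmeas : MeasurableSet {y : EuclideanSpace ℝ (Fin d) | diagForm w y ≤ 1 / t} :=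
    measurableSet_le (by fun_prop) measurable_const
  calc ENNReal.ofReal (C₁ * C₂ * gammaProfile (N / τ + -(diagRank w : ℝ) / 2) δ t)
      = ENNReal.ofReal (C₁ * gammaProfile (N / τ) δ t) *
          ENNReal.ofReal (C₂ * t ^ (-(diagRank w : ℝ) / 2)) := by
        rw [← ENNReal.ofReal_mul (by positivity), ← gammaProfile_mul_rpow ht0]
        ring_nf
    _ ≤ ENNReal.ofReal (C₁ * gammaProfile (N / τ) δ t) *
          uniformSphere d {y | diagForm w y ≤ 1 / t} := by
        gcongr
        exact hsphere t ht
    _ = ∫⁻ _ in {y | diagForm w y ≤ 1 / t},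
          ENNReal.ofReal (C₁ * gammaProfile (N / τ) δ t) ∂uniformSphere d :=
        (setLIntegral_const _ _).symm
    _ ≤ ∫⁻ y in {y | diagForm w y ≤ 1 / t},
          ν {r | t ^ (1 / τ) ≤ |r| * √(1 - diagForm w y)} ∂uniformSphere d :=
        setLIntegral_mono' hmeas fun y hy => hscaled _ (diagForm_nonneg hw y) hy
    _ ≤ _ := setLIntegral_le_lintegral _ _

theorem isTheta_ellipticalLaw_tail (hν : IsKotzIIIRadius ν c N δ τ) (hc : c ≠ 0) (hδ : 0 < δ)
    (hτ : 0 < τ) {A : Matrix (Fin d) (Fin d) ℝ} (hA : topEigenvalue A = 1) :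
    (fun t => (ellipticalLaw A ν).real {x | t ^ (1 / τ) ≤ ‖x‖}) =Θ[atTop]
      gammaProfile (N / τ - ((d : ℝ) - topMultiplicity A) / 2) δ := by
  have := hν.isProbabilityMeasure
  set w := 1 - sigmaEigenvalues A with hw_def
  have hw0 : 0 ≤ w := fun i =>
    sub_nonneg.2 ((sigmaEigenvalues_le_topEigenvalue A i).trans_eq hA)
  have hw1 : w ≤ 1 := sub_le_self _ (sigmaEigenvalues_nonneg A)
  have hnull : ∃ i, w i = 0 :=
    (exists_sigmaEigenvalues_eq_topEigenvalue A).imp fun i hi => by simp [hw_def, hi, hA]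
  obtain ⟨C₁, hC₁, hupper⟩ := hν.exists_eventually_lintegral_scaled_tail_le hc hδ hτ hw0 hw1
  obtain ⟨C₂, hC₂, hlower⟩ := hν.exists_eventually_le_lintegral_scaled_tail hc hτ hw0 hnull
  simp only [← ellipticalLaw_norm_ge, diagRank_one_sub_sigmaEigenvalues A hA, hw_def, neg_div,
    ← sub_eq_add_neg] at hupper hlower
  constructor
  · refine .of_bound C₁ ?_
    filter_upwards [hupper, eventually_gt_atTop 0] with t hupper ht
    have hg := (gammaProfile_pos (δ := δ) ht
      (M := N / τ - ((d : ℝ) - topMultiplicity A) / 2)).le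
    rw [Real.norm_of_nonneg measureReal_nonneg, Real.norm_of_nonneg hg]
    exact ENNReal.toReal_le_of_le_ofReal (by positivity) hupper
  · refine .of_bound C₂⁻¹ ?_
    filter_upwards [hupper, hlower, eventually_gt_atTop 0] with t hupper hlower ht
    have hg := (gammaProfile_pos (δ := δ) ht
      (M := N / τ - ((d : ℝ) - topMultiplicity A) / 2)).le
    rw [Real.norm_of_nonneg measureReal_nonneg, Real.norm_of_nonneg hg, le_inv_mul_iff₀ hC₂]
    exact (ENNReal.ofReal_le_iff_le_toReal (hupper.trans_lt ENNReal.ofReal_lt_top).ne).1 hlower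

end IsKotzIIIRadius

section Levels

theorem isEquivalent_add_mul_log (s : ℝ) :
    (fun x : ℝ => x + s * Real.log x) ~[atTop] fun x => x :=
  IsEquivalent.refl.add_isLittleO (Real.isLittleO_log_id_atTop.const_mul_left s)

theorem tendsto_add_mul_log_atTop (s : ℝ) :
    Tendsto (fun x : ℝ => x + s * Real.log x) atTop atTop :=
  (isEquivalent_add_mul_log s).symm.tendsto_atTop tendsto_id

theorem monotoneOn_add_mul_log (s : ℝ) :
    MonotoneOn (fun x : ℝ => x + s * Real.log x) (Set.Ioi 0 ∩ Set.Ici |s|) := by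
  rintro x ⟨hx, hsx⟩ y - hxy
  rw [Set.mem_Ioi] at hx
  have hlog : Real.log y - Real.log x ≤ (y - x) / x := by
    rw [← Real.log_div (hx.trans_le hxy).ne' hx.ne', sub_div, div_self hx.ne']
    exact Real.log_le_sub_one_of_pos (div_pos (hx.trans_le hxy) hx)
  have hlog0 : 0 ≤ Real.log y - Real.log x := sub_nonneg.2 (Real.log_le_log hx hxy)
  have hslog : |s| * (Real.log y - Real.log x) ≤ y - x :=
    calc |s| * (Real.log y - Real.log x) ≤ x * ((y - x) / x) := mul_le_mul hsx hlog hlog0 hx.le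
      _ = y - x := mul_div_cancel₀ _ hx.ne'
  have := mul_le_mul_of_nonneg_right (neg_abs_le s) hlog0
  dsimp only
  linarith

theorem isTheta_gammaProfile_mul_add_mul_log {δ τ : ℝ} (hτ : 0 < τ) (hδτ : δ * τ = 1) (p s : ℝ) :
    (fun x => gammaProfile p δ (τ * (x + s * Real.log x))) =Θ[atTop]
      fun x => Real.exp (-x) * x ^ (p - s) := by
  have hpow : (fun x : ℝ => (τ * (x + s * Real.log x)) ^ p) =Θ[atTop] fun x => x ^ p :=
    ((isEquivalent_add_mul_log s).isTheta.const_mul_left hτ.ne').rpow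
      (((tendsto_add_mul_log_atTop s).const_mul_atTop hτ).eventually_ge_atTop 0)
      (eventually_ge_atTop 0)
  refine (hpow.mul (isTheta_refl _ _)).trans (EventuallyEq.isTheta ?_)
  filter_upwards [eventually_gt_atTop 0] with x hx
  have hexp : Real.exp (-(s * Real.log x)) = x ^ (-s) := by
    rw [Real.rpow_def_of_pos hx]
    ring_nf
  rw [← mul_assoc δ, hδτ, one_mul, neg_add, Real.exp_add, hexp, sub_eq_add_neg, Real.rpow_add hx]
  ring

theorem tendsto_log_natCast_atTop : Tendsto (fun n : ℕ => Real.log n) atTop atTop :=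
  Real.tendsto_log_atTop.comp tendsto_natCast_atTop_atTop

theorem tendsto_bStar_atTop {τ : ℝ} (hτ : 0 < τ) (s : ℝ) : Tendsto (bStar τ s) atTop atTop :=
  (tendsto_rpow_atTop (one_div_pos.2 hτ)).comp
    (((tendsto_add_mul_log_atTop s).comp tendsto_log_natCast_atTop).const_mul_atTop hτ)

theorem exists_monotoneOn_bStar {τ : ℝ} (hτ : 0 < τ) (s : ℝ) :
    ∃ n₀, MonotoneOn (bStar τ s) (Set.Ici n₀) := by
  have hlevel := (tendsto_add_mul_log_atTop s).comp tendsto_log_natCast_atTop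
  obtain ⟨n₀, hn₀⟩ := eventually_atTop.1 ((eventually_gt_atTop 0).and
    ((tendsto_log_natCast_atTop.eventually_gt_atTop 0).and
      ((tendsto_log_natCast_atTop.eventually_ge_atTop |s|).and (hlevel.eventually_ge_atTop 0))))
  refine ⟨n₀, fun n hn k hk hnk => ?_⟩
  obtain ⟨hn0, hlog, hslog, hlevel⟩ := hn₀ n hn
  obtain ⟨-, hlog', hslog', -⟩ := hn₀ k hk
  have hle := monotoneOn_add_mul_log s ⟨hlog, hslog⟩ ⟨hlog', hslog'⟩
    (Real.log_le_log (by exact_mod_cast hn0) (by exact_mod_cast hnk))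
  exact Real.rpow_le_rpow (mul_nonneg hτ.le hlevel) (mul_le_mul_of_nonneg_left hle hτ.le)
    (one_div_nonneg.2 hτ.le)

end Levels

section LogarithmicSeries

variable {a : ℝ}

theorem two_pow_mul_inv_mul_log_rpow (a : ℝ) (k : ℕ) :
    (2 : ℝ) ^ k * (((2 ^ k : ℕ) : ℝ)⁻¹ * Real.log ((2 ^ k : ℕ) : ℝ) ^ a) =
      (k : ℝ) ^ a * Real.log 2 ^ a := by
  rw [Nat.cast_pow, Nat.cast_ofNat, mul_inv_cancel_left₀ (by positivity), Real.log_pow,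
    Real.mul_rpow (by positivity) (Real.log_nonneg one_le_two)]

theorem inv_mul_log_rpow_succ_le (ha : a ≤ 0) {k : ℕ} (hk : 2 ≤ k) :
    ((k + 1 : ℕ) : ℝ)⁻¹ * Real.log ((k + 1 : ℕ) : ℝ) ^ a ≤ (k : ℝ)⁻¹ * Real.log k ^ a := by
  have hk1 : (1 : ℝ) < k := by exact_mod_cast hk
  have hle : (k : ℝ) ≤ ((k + 1 : ℕ) : ℝ) := by exact_mod_cast k.le_succ
  have hlog : Real.log ((k + 1 : ℕ) : ℝ) ^ a ≤ Real.log k ^ a :=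
    Real.rpow_le_rpow_of_nonpos (Real.log_pos hk1) (Real.log_le_log (by linarith) hle) ha
  have := Real.rpow_nonneg (Real.log_natCast_nonneg (k + 1)) a
  gcongr

theorem not_summable_inv_mul_log_rpow (ha : 0 ≤ a) :
    ¬ Summable fun n : ℕ => (n : ℝ)⁻¹ * Real.log n ^ a := by
  refine fun h => Real.not_summable_natCast_inv (summable_of_isBigO_nat h (.of_bound' ?_))
  filter_upwards [tendsto_log_natCast_atTop.eventually_ge_atTop 1] with n hn
  have hlog : 1 ≤ Real.log n ^ a := Real.one_le_rpow hn ha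
  rw [norm_mul, Real.norm_of_nonneg (zero_le_one.trans hlog)]
  exact le_mul_of_one_le_right (norm_nonneg _) hlog

theorem summable_inv_mul_log_rpow_iff :
    Summable (fun n : ℕ => (n : ℝ)⁻¹ * Real.log n ^ a) ↔ a < -1 := by
  rcases lt_or_ge 0 a with ha | ha
  · exact iff_of_false (not_summable_inv_mul_log_rpow ha.le) (by linarith)
  rw [← summable_condensed_iff_of_eventually_nonneg (.of_forall fun n =>
      mul_nonneg (by positivity) (Real.rpow_nonneg (Real.log_natCast_nonneg _) _))
    ((eventually_ge_atTop 2).mono fun k hk => inv_mul_log_rpow_succ_le ha hk)]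
  simp only [two_pow_mul_inv_mul_log_rpow]
  rw [summable_mul_right_iff (Real.rpow_pos_of_pos (Real.log_pos one_lt_two) _).ne',
    Real.summable_nat_rpow]

end LogarithmicSeries

theorem IsKotzIIIRadius.isTheta_ellipticalLaw_tail_bStar {d : ℕ} [NeZero d] {ν : Measure ℝ}
    {c N δ τ : ℝ} (hν : IsKotzIIIRadius ν c N δ τ) (hc : c ≠ 0) (hδ : 0 < δ) (hτ : 0 < τ)
    (hδτ : δ * τ = 1) {A : Matrix (Fin d) (Fin d) ℝ} (hA : topEigenvalue A = 1) (s : ℝ) :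
    (fun n : ℕ => (ellipticalLaw A ν).real {x | bStar τ s n ≤ ‖x‖}) =Θ[atTop]
      fun n : ℕ => (n : ℝ)⁻¹ *
        Real.log n ^ (N / τ - ((d : ℝ) - topMultiplicity A) / 2 - s) := by
  have htail := hν.isTheta_ellipticalLaw_tail hc hδ hτ hA
  have hlevel := (tendsto_add_mul_log_atTop s).const_mul_atTop hτ
  have hreal := IsTheta.trans ⟨htail.1.comp_tendsto hlevel, htail.2.comp_tendsto hlevel⟩
    (isTheta_gammaProfile_mul_add_mul_log hτ hδτ _ s)
  refine IsTheta.trans ⟨hreal.1.comp_tendsto tendsto_log_natCast_atTop,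
    hreal.2.comp_tendsto tendsto_log_natCast_atTop⟩ (EventuallyEq.isTheta ?_)
  filter_upwards [eventually_gt_atTop 0] with n hn
  simp only [Function.comp_apply, Real.exp_neg, Real.exp_log (Nat.cast_pos.2 hn)]

section MaxNorm

variable {E : Type*} [Norm E] (x : ℕ → E)

theorem norm_le_maxNorm {j n : ℕ} (hj : j < n) : ‖x j‖ ≤ maxNorm x n :=
  le_ciSup (f := fun i : Fin n => ‖x i‖) (Set.finite_range _).bddAbove ⟨j, hj⟩

theorem exists_norm_eq_maxNorm {n : ℕ} (hn : 0 < n) : ∃ j < n, ‖x j‖ = maxNorm x n := by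
  have : Nonempty (Fin n) := ⟨⟨0, hn⟩⟩
  obtain ⟨i, hi⟩ := exists_eq_ciSup_of_finite (f := fun i : Fin n => ‖x i‖)
  exact ⟨i, i.2, hi⟩

theorem frequently_le_maxNorm_iff {b : ℕ → ℝ} (hb : Tendsto b atTop atTop) {n₀ : ℕ}
    (hmono : MonotoneOn b (Set.Ici n₀)) :
    (∃ᶠ n in atTop, b n ≤ maxNorm x n) ↔ ∃ᶠ j in atTop, b (j + 1) ≤ ‖x j‖ := by
  constructor
  · contrapose!
    intro hsmall
    obtain ⟨J, hJ⟩ := eventually_atTop.1 (hsmall.and (eventually_ge_atTop n₀))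
    filter_upwards [eventually_gt_atTop 0, hb.eventually_gt_atTop (maxNorm x J)] with n hn hbn
    obtain ⟨j, hjn, hxj⟩ := exists_norm_eq_maxNorm x hn
    rw [← hxj]
    rcases lt_or_ge j J with hjJ | hJj
    · exact (norm_le_maxNorm x hjJ).trans_lt hbn
    · obtain ⟨hlt, hj⟩ := hJ j hJj
      have hj1 : n₀ ≤ j + 1 := hj.trans j.le_succ
      exact hlt.trans_le (hmono hj1 (hj1.trans hjn) hjn)
  · intro h
    exact (tendsto_add_atTop_nat 1).frequently
      (h.mono fun j hj => hj.trans (norm_le_maxNorm x j.lt_succ_self))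

end MaxNorm

section BorelCantelli

variable {Ω E : Type*} [MeasurableSpace Ω] [MeasurableSpace E] {P : Measure Ω} {μ : ℕ → Measure E}
  {X : ℕ → Ω → E} {S : ℕ → Set E}

theorem measure_frequently_mem_eq_zero [IsFiniteMeasure P] (hX : ∀ j, HasLaw (X j) (μ j) P)
    (hS : ∀ j, MeasurableSet (S j)) (hsum : Summable fun j => (μ j).real (S j)) :
    P {ω | ∃ᶠ j in atTop, X j ω ∈ S j} = 0 := by
  have hmeas : ∀ j, P {ω | X j ω ∈ S j} = ENNReal.ofReal ((μ j).real (S j)) := fun j => by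
    rw [← (hX j).map_eq, ofReal_measureReal,
      Measure.map_apply_of_aemeasurable (hX j).aemeasurable (hS j)]
    rfl
  refine measure_setOfPred_frequently_eq_zero ?_
  simp only [hmeas]
  exact hsum.tsum_ofReal_ne_top

theorem measure_frequently_mem_eq_one [IsProbabilityMeasure P] (hX : ∀ j, HasLaw (X j) (μ j) P)
    (hindep : iIndepFun X P) (hS : ∀ j, MeasurableSet (S j))
    (hsum : ¬ Summable fun j => (μ j).real (S j)) :
    P {ω | ∃ᶠ j in atTop, X j ω ∈ S j} = 1 := by
  let Y : ℕ → Ω → E := fun j => (hX j).aemeasurable.mk (X j)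
  have hY : ∀ j, MeasurableSet (Y j ⁻¹' S j) := fun j => (hX j).aemeasurable.measurable_mk (hS j)
  have hXY : ∀ j, X j =ᵐ[P] Y j := fun j => (hX j).aemeasurable.ae_eq_mk
  have hindepY : iIndepSet (fun j => Y j ⁻¹' S j) P := (iIndepSet_iff_meas_biInter hY).2 fun _ =>
    (hindep.congr hXY).meas_biInter fun j _ => ⟨_, hS j, rfl⟩
  have hdiv : ∑' j, P (Y j ⁻¹' S j) = ⊤ := by
    by_contra htop
    refine hsum ((ENNReal.summable_toReal htop).congr fun j => ?_)
    rw [measureReal_def, ← (hX j).map_eq, Measure.map_congr (hXY j),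
      Measure.map_apply (hX j).aemeasurable.measurable_mk (hS j)]
  rw [← measure_limsup_eq_one hY hindepY hdiv]
  refine measure_congr ?_
  filter_upwards [ae_all_iff.2 hXY] with ω hω
  change (∃ᶠ j in atTop, X j ω ∈ S j) = (ω ∈ limsup (fun j => Y j ⁻¹' S j) atTop)
  rw [mem_limsup_iff_frequently_mem]
  simp only [hω]
  rfl

end BorelCantelli

theorem theorem2 {d : ℕ} (hd : 2 ≤ d) (A : Matrix (Fin d) (Fin d) ℝ)
    (hA : topEigenvalue A = 1)
    {c δ τ : ℝ} (hc : 0 < c) (hδ : 0 < δ) (hτ : 0 < τ) (N : ℝ) (hδτ : δ * τ = 1)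
    (ν : Measure ℝ) (hν : IsKotzIIIRadius ν c N δ τ)
    {Ω : Type*} [MeasurableSpace Ω] (P : Measure Ω) [IsProbabilityMeasure P]
    (X : ℕ → Ω → EuclideanSpace ℝ (Fin d))
    (hX : ∀ j, HasLaw (X j) (ellipticalLaw A ν) P)
    (hindep : iIndepFun X P) (s : ℝ) :
    (s ≤ N / τ - ((d : ℝ) - (topMultiplicity A : ℝ)) / 2 + 1 →
      P {ω | ∃ᶠ n : ℕ in atTop, bStar τ s n ≤ maxNorm (fun j => X j ω) n} = 1) ∧
    (N / τ - ((d : ℝ) - (topMultiplicity A : ℝ)) / 2 + 1 < s →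
      P {ω | ∃ᶠ n : ℕ in atTop, bStar τ s n ≤ maxNorm (fun j => X j ω) n} = 0) := by
  have : NeZero d := ⟨by lia⟩
  have hsum : Summable (fun j : ℕ => (ellipticalLaw A ν).real {x | bStar τ s (j + 1) ≤ ‖x‖}) ↔
      N / τ - ((d : ℝ) - topMultiplicity A) / 2 - s < -1 := by
    rw [summable_nat_add_iff (f := fun n => (ellipticalLaw A ν).real {x | bStar τ s n ≤ ‖x‖}) 1,
      (hν.isTheta_ellipticalLaw_tail_bStar hc.ne' hδ hτ hδτ hA s).summable_iff_nat,
      summable_inv_mul_log_rpow_iff]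
  have hmeas : ∀ j : ℕ, MeasurableSet
      {x : EuclideanSpace ℝ (Fin d) | bStar τ s (j + 1) ≤ ‖x‖} :=
    fun j => measurableSet_le measurable_const measurable_norm
  obtain ⟨n₀, hmono⟩ := exists_monotoneOn_bStar hτ s
  simp only [frequently_le_maxNorm_iff _ (tendsto_bStar_atTop hτ s) hmono]
  exact ⟨fun hs => measure_frequently_mem_eq_one (S := fun j => {x | bStar τ s (j + 1) ≤ ‖x‖})
      hX hindep hmeas (mt hsum.1 (by linarith)),
    fun hs => measure_frequently_mem_eq_zero (S := fun j => {x | bStar τ s (j + 1) ≤ ‖x‖})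
      hX hmeas (hsum.2 (by linarith))⟩
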